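/- Let $F$ be a field, let $n,k\ge 0$ be integers, $\mathbb L=\mathbb Z^n$, and let $\mathbb S\subset\mathbb L$ be a sublattice, that is, an arbitrary subgroup (of any rank, not necessarily diagonal). Let $A=F[\sigma_1,\sigma_1^{-1},\ldots,\sigma_n,\sigma_n^{-1}]$ be the Laurent polynomial ring, with monomials $\sigma^s$, $s\in\mathbb L$, and let $A_{\mathbb S}\subset A$ be the $F$-subalgebra generated by the monomials $\sigma^s$ with $s\in\mathbb S$. Let $\mathcal F_{\mathbb L}$ and $\mathcal F_{\mathbb S}$ be the spaces of all $F$-valued functions on $\mathbb L$ and on $\mathbb S$; $A$ acts on $\mathcal F_{\mathbb L}$ and $A_{\mathbb S}$ acts on $\mathcal F_{\mathbb S}$, $F$-linearly, by shifts, $(\sigma^s f)(x)=f(x+s)$. For a submodule $P\subset A^k$ put $$\mathrm{Ker}_{\mathcal F_{\mathbb L}}(P)=\Big\{(f_1,\ldots,f_k)\in\mathcal F_{\mathbb L}^k : \sum_{j=1}^k p_jf_j=0\ \text{ for all } (p_1,\ldots,p_k)\in P\Big\},$$ and define $\mathrm{Ker}_{\mathcal F_{\mathbb S}}(Q)\subset\mathcal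 F_{\mathbb S}^k$ in the same way for an $A_{\mathbb S}$-submodule $Q\subset A_{\mathbb S}^k$. The contraction of $P$ to $\mathbb S$ is the $A_{\mathbb S}$-submodule $P^c=P\cap A_{\mathbb S}^k$ of $A_{\mathbb S}^k$. Let $G$ be $\mathbb L$ or $\mathbb S$, with the distance $d(x,y)=\|x-y\|_1=\sum_i|x_i-y_i|$ of $\mathbb Z^n$. For $\mathcal B\subset\mathcal F_G^k$ and $T\subset G$, let $\mathcal B(T)$ be the set of restrictions to $T$ of the elements of $\mathcal B$. The system $\mathcal B$ is called controllable if there is a real $\rho>0$ such that for all subsets $T_1,T_2\subset G$ with $d(x,y)>\rho$ for all $x\in T_1$, $y\in T_2$, one has $\mathcal B(T_1\cup T_2)=\mathcal B(T_1)\times\mathcal B(T_2)$, where a function on $T_1\cup T_2$ is identified with the pair of its restrictions to $T_1$ and $T_2$. **Proposition 7.1.** If $\mathrm{Ker}_{\mathcal F_{\mathbb L}}(P)$ is controllable, then the contracted system $\mathrm{Ker}_{\mathcal F_{\mathbb S}}(P^c)$ on $\mathbb S$ is also controllable. -/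

import Mathlib

namespace NDSystem

/-- The ring of partial difference operators with coefficients in `F` on a lattice `G`: the
Laurent polynomial ring whose monomials `σ ^ s` correspond to the points `s` of `G`. -/
abbrev DiffOp (F G : Type*) [Field F] [AddCommGroup G] : Type _ := AddMonoidAlgebra F G

/-- The action of difference operators on signals `f : G → F`: the monomial `σ ^ s` sends `f`
to `x ↦ f (x + s)`, extended `F`-linearly to all operators. -/
noncomputable def act {F G : Type*} [Field F] [AddCommGroup G] (a : DiffOp F G) (f : G → F) :
    G → F :=
  fun x => ∑ s ∈ a.coeff.support, a.coeff s * f (x + s)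

/-- The system defined on the lattice `G` by a submodule `P` of `A ^ k`: the set of all
`w = (w 1, …, w k)` such that `∑ j, p j • w j = 0` for all `p ∈ P`. -/
def Ker {F G : Type*} [Field F] [AddCommGroup G] {k : ℕ}
    (P : Submodule (DiffOp F G) (Fin k → DiffOp F G)) : Set (Fin k → G → F) :=
  {w | ∀ p ∈ P, ∑ j, act (p j) (w j) = 0}

/-- The inclusion of the ring of difference operators on a sublattice `S` into the ring of
difference operators on the lattice; it sends the monomial of `s ∈ S` to the monomial of `s`. -/
noncomputable def incl (F : Type*) [Field F] {G : Type*} [AddCommGroup G] (S : AddSubgroup G) :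
    DiffOp F S →ₐ[F] DiffOp F G :=
  AddMonoidAlgebra.mapDomainAlgHom F F S.subtype

/-- `incl` is injective, so that `DiffOp F S` is a subalgebra of `DiffOp F G`. -/
theorem incl_injective (F : Type*) [Field F] {G : Type*} [AddCommGroup G] (S : AddSubgroup G) :
    Function.Injective (incl F S) :=
  AddMonoidAlgebra.mapDomain_injective S.subtype_injective

/-- The subalgebra in question is the one generated by the monomials of the points of `S`. -/
theorem range_incl (F : Type*) [Field F] {G : Type*} [AddCommGroup G] (S : AddSubgroup G) :
    (incl F S).range =
      Algebra.adjoin F ((fun s : G => (AddMonoidAlgebra.single s 1 : DiffOp F G)) '' S) := by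
  apply le_antisymm
  · rintro _ ⟨a, rfl⟩
    change incl F S a ∈ _
    induction a using AddMonoidAlgebra.induction_linear with
    | zero => rw [map_zero]; exact Subalgebra.zero_mem _
    | add p q hp hq => rw [map_add]; exact Subalgebra.add_mem _ hp hq
    | single s c =>
      have h : incl F S (AddMonoidAlgebra.single s c) =
          c • (AddMonoidAlgebra.single (s : G) 1 : DiffOp F G) := by
        simp [incl]
      rw [h]
      exact Subalgebra.smul_mem _ (Algebra.subset_adjoin (Set.mem_image_of_mem _ s.2)) c
  · rw [Algebra.adjoin_le_iff]
    rintro _ ⟨s, hs, rfl⟩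
    exact ⟨AddMonoidAlgebra.single ⟨s, hs⟩ 1, by simp [incl]⟩

/-- The contraction `P ∩ (A_S) ^ k` of a submodule `P` of `A ^ k` to a sublattice `S`. -/
noncomputable def contraction {F G : Type*} [Field F] [AddCommGroup G] {k : ℕ}
    (S : AddSubgroup G) (P : Submodule (DiffOp F G) (Fin k → DiffOp F G)) :
    Submodule (DiffOp F S) (Fin k → DiffOp F S) where
  carrier := {q | (fun j => incl F S (q j)) ∈ P}
  zero_mem' := by
    have h : (fun j : Fin k => incl F S ((0 : Fin k → DiffOp F S) j)) = 0 := by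
      funext j; simp
    change _ ∈ P
    rw [h]
    exact P.zero_mem
  add_mem' := by
    intro p q hp hq
    have h : (fun j => incl F S ((p + q) j)) =
        (fun j => incl F S (p j)) + fun j => incl F S (q j) := by
      funext j; simp
    change _ ∈ P
    rw [h]
    exact P.add_mem hp hq
  smul_mem' := by
    intro a q hq
    have h : (fun j => incl F S ((a • q) j)) = incl F S a • fun j => incl F S (q j) := by
      funext j; simp
    change _ ∈ P
    rw [h]
    exact P.smul_mem _ hq

/-- The restriction `B(T)` of the trajectories of `B` to a subset `T` of the lattice. -/
def restrictTo {F G : Type*} {k : ℕ} (B : Set (Fin k → G → F)) (T : Set G) :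
    Set (Fin k → T → F) :=
  (fun w j x => w j x) '' B

/-- The canonical map sending a function on `T₁ ∪ T₂` to the pair of its restrictions to
`T₁` and to `T₂`. -/
def splitUnion {F G : Type*} {k : ℕ} (T₁ T₂ : Set G) (u : Fin k → ↥(T₁ ∪ T₂) → F) :
    (Fin k → T₁ → F) × (Fin k → T₂ → F) :=
  (fun j x => u j ⟨x, Or.inl x.2⟩, fun j x => u j ⟨x, Or.inr x.2⟩)

/-- Controllability of a system `B` on a lattice `G` with distance `d`: for some real `ρ > 0`,
whenever `d(T₁, T₂) > ρ`, i.e. all points of `T₁` have distance more than `ρ` from all points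
of `T₂`, one has `B(T₁ ∪ T₂) = B(T₁) × B(T₂)` under the canonical (injective) identification. -/
def IsControllable {F G : Type*} {k : ℕ} (d : G → G → ℤ) (B : Set (Fin k → G → F)) : Prop :=
  ∃ ρ : ℝ, 0 < ρ ∧ ∀ T₁ T₂ : Set G, (∀ x ∈ T₁, ∀ y ∈ T₂, ρ < (d x y : ℝ)) →
    splitUnion T₁ T₂ '' restrictTo B (T₁ ∪ T₂) = restrictTo B T₁ ×ˢ restrictTo B T₂

/-- The `L₁` distance on `ℤ ^ n`. -/
def l1Dist {n : ℕ} (x y : Fin n → ℤ) : ℤ := ∑ i, |x i - y i|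

end NDSystem

namespace NDSystem

/-! Signals in `k` components are exactly the `F`-linear functionals on `A^k`, via evaluation at the
origin, and `Ker P` is the annihilator of `P`. Since `A_S^k / P^c` embeds in `A^k / P` and
functionals on a subspace over a field extend, every trajectory of the contracted system is the
restriction to `S` of a trajectory of `Ker P` (`Ker_contraction`). Restriction to `S` preserves
controllability with the same `ρ`, since subsets of `S` are subsets of the lattice at the same
distance (`IsControllable.restrict`). -/

variable {F G : Type*} [Field F] [AddCommGroup G] {k : ℕ}

/-- The `F`-bilinear pairing of operators with signals, `a ↦ (a f)(x)`. -/
noncomputable def actAt (f : G → F) (x : G) : DiffOp F G →ₗ[F] F :=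
  (Finsupp.linearCombination F fun s => f (x + s)) ∘ₗ
    (AddMonoidAlgebra.coeffLinearEquiv F).toLinearMap

theorem actAt_apply (f : G → F) (x : G) (a : DiffOp F G) : actAt f x a = act a f x := rfl

@[simp]
theorem actAt_single (f : G → F) (x s : G) (c : F) :
    actAt f x (AddMonoidAlgebra.single s c) = c * f (x + s) := by
  simp [actAt]

/-- Moves evaluation from `x` to the origin, so that a module of equations need only be tested at
`0`. -/
theorem actAt_zero_monomial_mul (f : G → F) (x : G) (a : DiffOp F G) :
    actAt f 0 (AddMonoidAlgebra.single x 1 * a) = actAt f x a := by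
  induction a using AddMonoidAlgebra.induction_linear with
  | zero => simp
  | add p q hp hq => rw [mul_add, map_add, map_add, hp, hq]
  | single s c => simp [AddMonoidAlgebra.single_mul_single]

/-- The pairing of vectors of operators with a vector of signals. -/
noncomputable def pairing (w : Fin k → G → F) : (Fin k → DiffOp F G) →ₗ[F] F :=
  ∑ j, actAt (w j) 0 ∘ₗ LinearMap.proj j

theorem pairing_apply (w : Fin k → G → F) (p : Fin k → DiffOp F G) :
    pairing w p = ∑ j, actAt (w j) 0 (p j) := by
  simp [pairing]

theorem pairing_single (w : Fin k → G → F) (j : Fin k) (s : G) :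
    pairing w (Pi.single j (AddMonoidAlgebra.single s 1)) = w j s := by
  rw [pairing_apply, Finset.sum_eq_single j]
  · simp
  · intro i _ hi
    rw [Pi.single_eq_of_ne hi, map_zero]
  · simp

/-- Every linear functional on the free module is the pairing with a vector of signals. -/
theorem eq_pairing (φ : (Fin k → DiffOp F G) →ₗ[F] F) :
    φ = pairing fun j s => φ (Pi.single j (AddMonoidAlgebra.single s 1)) := by
  refine LinearMap.pi_ext fun j a => ?_
  induction a using AddMonoidAlgebra.induction_linear with
  | zero => simp
  | add p q hp hq => rw [Pi.single_add, map_add, map_add, hp, hq]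
  | single s c =>
    have h : (Pi.single j (AddMonoidAlgebra.single s c) : Fin k → DiffOp F G) =
        c • Pi.single j (AddMonoidAlgebra.single s 1) := by
      rw [← Pi.single_smul, AddMonoidAlgebra.smul_single, smul_eq_mul, mul_one]
    rw [h, map_smul, map_smul, pairing_single]

/-- A system is the annihilator of its module of equations under the pairing. -/
theorem mem_Ker_iff_pairing (P : Submodule (DiffOp F G) (Fin k → DiffOp F G))
    (w : Fin k → G → F) : w ∈ Ker P ↔ ∀ p ∈ P, pairing w p = 0 := by
  constructor
  · intro h p hp
    have := congrFun (h p hp) 0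
    simpa [pairing_apply, actAt_apply] using this
  · intro h p hp
    funext x
    have := h _ (P.smul_mem (AddMonoidAlgebra.single x 1) hp)
    rw [pairing_apply] at this
    simp only [Pi.smul_apply, smul_eq_mul, actAt_zero_monomial_mul] at this
    simpa [actAt_apply] using this

theorem actAt_incl (S : AddSubgroup G) (f : G → F) (a : DiffOp F S) :
    actAt f 0 (incl F S a) = actAt (fun s : S => f s) 0 a := by
  induction a using AddMonoidAlgebra.induction_linear with
  | zero => simp
  | add p q hp hq => rw [map_add, map_add, map_add, hp, hq]
  | single s c => simp [incl]

/-- The inclusion of the free modules, componentwise `incl`. -/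
noncomputable def inclVec (F : Type*) [Field F] (S : AddSubgroup G) (k : ℕ) :
    (Fin k → DiffOp F S) →ₗ[F] (Fin k → DiffOp F G) :=
  (incl F S).toLinearMap.compLeft (Fin k)

theorem pairing_inclVec (S : AddSubgroup G) (w : Fin k → G → F) (q : Fin k → DiffOp F S) :
    pairing w (inclVec F S k q) = pairing (fun j (s : S) => w j s) q := by
  simp [pairing_apply, inclVec, actAt_incl]

/-- The contracted system consists of the restrictions to the sublattice of the trajectories
of the original system. -/
theorem Ker_contraction (S : AddSubgroup G)
    (P : Submodule (DiffOp F G) (Fin k → DiffOp F G)) :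
    Ker (contraction S P) = (fun w j (s : S) => w j s) '' Ker P := by
  ext v
  constructor
  · intro hv
    rw [mem_Ker_iff_pairing] at hv
    let g := (P.restrictScalars F).mkQ ∘ₗ inclVec F S k
    -- The kernel of `g` is the contraction, which `pairing v` annihilates; over a field it
    -- therefore factors through `g` as some `ψ` on the whole quotient by `P`.
    have hmem : pairing v ∈ LinearMap.range g.dualMap := by
      rw [LinearMap.range_dualMap_eq_dualAnnihilator_ker, Submodule.mem_dualAnnihilator]
      intro q hq
      refine hv q ?_
      have : inclVec F S k q ∈ P.restrictScalars F := by
        simpa [g] using hq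
      exact this
    obtain ⟨ψ, hψ⟩ := hmem
    obtain ⟨w, hw⟩ : ∃ w, ψ ∘ₗ (P.restrictScalars F).mkQ = pairing w := ⟨_, eq_pairing _⟩
    refine ⟨w, (mem_Ker_iff_pairing P w).2 fun p hp => ?_, ?_⟩
    · have h0 : (P.restrictScalars F).mkQ p = 0 := by
        simpa using hp
      rw [← hw, LinearMap.comp_apply, h0, map_zero]
    · funext j s
      refine (pairing_single (fun j (s : S) => w j s) j s).symm.trans ?_
      rw [← pairing_single v, ← pairing_inclVec, ← hψ, ← hw]
      rfl
  · rintro ⟨w, hw, rfl⟩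
    rw [mem_Ker_iff_pairing] at hw ⊢
    intro q hq
    rw [← pairing_inclVec]
    exact hw _ hq

/-- Only the inclusion of the product in the image has content: it says that any two trajectories
can be glued. -/
theorem splitUnion_restrictTo_eq_iff {F G : Type*} {k : ℕ} (B : Set (Fin k → G → F))
    (T₁ T₂ : Set G) :
    splitUnion T₁ T₂ '' restrictTo B (T₁ ∪ T₂) = restrictTo B T₁ ×ˢ restrictTo B T₂ ↔
      ∀ w₁ ∈ B, ∀ w₂ ∈ B, ∃ w ∈ B,
        (∀ j, ∀ x ∈ T₁, w j x = w₁ j x) ∧ ∀ j, ∀ x ∈ T₂, w j x = w₂ j x := by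
  constructor
  · intro h w₁ h₁ w₂ h₂
    have hm : ((fun j (x : T₁) => w₁ j x, fun j (x : T₂) => w₂ j x) :
        (Fin k → T₁ → F) × (Fin k → T₂ → F)) ∈ restrictTo B T₁ ×ˢ restrictTo B T₂ :=
      ⟨⟨w₁, h₁, rfl⟩, ⟨w₂, h₂, rfl⟩⟩
    rw [← h] at hm
    obtain ⟨_, ⟨w, hw, rfl⟩, he⟩ := hm
    exact ⟨w, hw, fun j x hx => congrFun (congrFun (congrArg Prod.fst he) j) ⟨x, hx⟩,
      fun j x hx => congrFun (congrFun (congrArg Prod.snd he) j) ⟨x, hx⟩⟩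
  · intro h
    apply Set.Subset.antisymm
    · rintro _ ⟨_, ⟨w, hw, rfl⟩, rfl⟩
      exact ⟨⟨w, hw, rfl⟩, ⟨w, hw, rfl⟩⟩
    · rintro ⟨_, _⟩ ⟨⟨w₁, h₁, rfl⟩, ⟨w₂, h₂, rfl⟩⟩
      obtain ⟨w, hw, e₁, e₂⟩ := h w₁ h₁ w₂ h₂
      exact ⟨_, ⟨w, hw, rfl⟩, Prod.ext (funext fun j => funext fun x => e₁ j x x.2)
        (funext fun j => funext fun x => e₂ j x x.2)⟩

/-- The restriction of a controllable system to a sublattice is controllable. -/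
theorem IsControllable.restrict {F G : Type*} [AddCommGroup G] {k : ℕ} {d : G → G → ℤ}
    {B : Set (Fin k → G → F)}
    (hB : IsControllable d B) (S : AddSubgroup G) :
    IsControllable (fun x y : S => d x y) ((fun w j (s : S) => w j s) '' B) := by
  obtain ⟨ρ, hρ, h⟩ := hB
  refine ⟨ρ, hρ, fun T₁ T₂ hT => ?_⟩
  rw [splitUnion_restrictTo_eq_iff]
  rintro _ ⟨w₁, h₁, rfl⟩ _ ⟨w₂, h₂, rfl⟩
  have hd : ∀ x ∈ Subtype.val '' T₁, ∀ y ∈ Subtype.val '' T₂, ρ < (d x y : ℝ) := by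
    rintro _ ⟨x, hx, rfl⟩ _ ⟨y, hy, rfl⟩
    exact hT x hx y hy
  obtain ⟨w, hw, e₁, e₂⟩ :=
    (splitUnion_restrictTo_eq_iff B _ _).1 (h _ _ hd) w₁ h₁ w₂ h₂
  exact ⟨_, ⟨w, hw, rfl⟩, fun j x hx => e₁ j x ⟨x, hx, rfl⟩,
    fun j x hx => e₂ j x ⟨x, hx, rfl⟩⟩

end NDSystem

theorem proposition7p1 {F : Type*} [Field F] (n k : ℕ)
    (P : Submodule (NDSystem.DiffOp F (Fin n → ℤ)) (Fin k → NDSystem.DiffOp F (Fin n → ℤ)))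
    (hP : NDSystem.IsControllable NDSystem.l1Dist (NDSystem.Ker P))
    (S : AddSubgroup (Fin n → ℤ)) :
    NDSystem.IsControllable (fun x y : S => NDSystem.l1Dist (x : Fin n → ℤ) (y : Fin n → ℤ))
      (NDSystem.Ker (NDSystem.contraction S P)) := by
  rw [NDSystem.Ker_contraction]
  exact hP.restrict S
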